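/- **Setting.** Let $N\ge 1$. A causal triangulation (CT) $\mathbf t$ with $N$ strips and periodic boundary condition is a triangulation of the torus obtained as follows. For each $i\in\mathbb Z/N$ the slice $\mathcal S\times\{i\}$ is a circle consisting of $n^i\ge 1$ edges. The strip between the slices $i$ and $i+1$ is a cyclic sequence of $n^i+n^{i+1}$ triangles; consecutive triangles share an edge joining a vertex of slice $i$ to a vertex of slice $i+1$, and each triangle has exactly one edge on the boundary of the strip, so that each edge of slice $i$ belongs to exactly one triangle of the strip above it and each edge of slice $i+1$ to exactly one triangle of the strip below it. View $\mathbf t=(V(\mathbf t),E(\mathbf t))$ as a graph on the torus (loops and multiple edges are allowed). Its dual $\mathbf t^*$ has the faces of $\mathbf t$ as vertices and, for each edge $e\in E(\mathbf t)$, one edge $e^*$ joining the two faces abutting $e$. For a finite graph $G=(V,E)$ and $p,q\in\mathbb R$ put $$Z_{FK}(p,q,G)=\sum_{w\in\{0,1\}^{E}}\Bigl(\prod_{e\in E}(1-p)^{1-w(e)}p^{w(e)}\Bigr)q^{k(w)},$$ where $k(w)$ is the number of connected components (isolated vertices included) of the graph with vertex set $V$ and edge set $\{e\in E:w(e)=1\}$.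 **Lemma 3.1 (duality).** Let $\mathbf t$ be a CT with periodic boundary condition, let $p\in(0,1)$ and $q\ge 1$, and let $$p^*=\frac{(1-p)q}{(1-p)q+p},\qquad\text{or equivalently}\qquad \frac{p^*}{1-p^*}\cdot\frac{p}{1-p}=q .$$ Then $$Z_{FK}(p,q,\mathbf t)\le\Bigl(\frac{p}{1-p^*}\Bigr)^{|E(\mathbf t)|}q^{|V(\mathbf t)|-|E(\mathbf t)|+1}\,Z_{FK}(p^*,q,\mathbf t^*)$$ and $$\Bigl(\frac{p}{1-p^*}\Bigr)^{|E(\mathbf t)|}q^{|V(\mathbf t)|-|E(\mathbf t)|-1}\,Z_{FK}(p^*,q,\mathbf t^*)\le Z_{FK}(p,q,\mathbf t).$$ -/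

import Mathlib

/-- A multigraph (loops and multiple edges allowed) with vertex set `V` and edge set `E`:
each edge `e` has an unordered pair `ends e` of (possibly equal) end vertices. -/
structure Multigraph (V E : Type) where
  ends : E → Sym2 V

namespace Multigraph

variable {V E : Type}

/-- The graph `(V, η(w))` of open edges (`w e = 1`) of a configuration `w ∈ {0,1}^E`. Loops and
multiplicities are forgotten, which does not affect connected components. -/
def openGraph (G : Multigraph V E) (w : E → Fin 2) : SimpleGraph V where
  Adj x y := x ≠ y ∧ ∃ e, w e = 1 ∧ G.ends e = s(x, y)
  symm := ⟨fun _ _ h => ⟨h.1.symm, by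
    obtain ⟨e, he, h2⟩ := h.2
    exact ⟨e, he, by rw [h2, Sym2.eq_swap]⟩⟩⟩
  loopless := ⟨fun _ h => h.1 rfl⟩

/-- `k(w)`: the number of open clusters of `w`, isolated vertices included. -/
noncomputable def numClusters (G : Multigraph V E) (w : E → Fin 2) : ℕ :=
  Nat.card (G.openGraph w).ConnectedComponent

open Classical in
/-- The FK (random-cluster) partition function
`Z_FK(p,q,G) = ∑_w (∏_e (1-p)^(1-w(e)) p^(w(e))) q^(k(w))`. -/
noncomputable def fkPartition [Fintype E] (p q : ℝ) (G : Multigraph V E) : ℝ :=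
  ∑ w : E → Fin 2,
    (∏ e, (1 - p) ^ (1 - (w e : ℕ)) * p ^ (w e : ℕ)) * q ^ G.numClusters w

end Multigraph

/-- A causal triangulation with `N` strips and periodic boundary condition (so a triangulation of
the torus; slice `N` is identified with slice `0`).

* The slice `S × {i}`, `i ∈ ℤ/N`, is a circle made of `n i ≥ 1` edges; its vertices are labelled
  cyclically by `ℤ/(n i)`, and its edge `a` joins the vertices `a` and `a + 1`.
* The strip `S × [i, i+1]` is a cyclic sequence of triangles, labelled in cyclic order by
  `ℤ/(n i + n (i+1))`. Each triangle has exactly one edge on the boundary of the strip: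
  an up-triangle (`isUp i k = true`) has it on the lower slice `i`, a down-triangle on the upper
  slice `i + 1`.
* Consecutive triangles `k - 1` and `k` of strip `i` share the `k`-th transversal edge, which joins
  the vertex `lo i k` of slice `i` to the vertex `hi i k` of slice `i + 1`. Passing an up-triangle
  moves the lower end one step, passing a down-triangle moves the upper end one step.
* Each edge of slice `i` is the base `lo i k` of exactly one up-triangle `k` of strip `i`, and each
  edge of slice `i + 1` is the base `hi i k` of exactly one down-triangle `k` of strip `i`.

The labels carry more information than a root does, and all relative rotations ("twists") of
the slices are allowed. -/
structure CausalTriangulation (N : ℕ) where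
  n : ZMod N → ℕ
  n_pos : ∀ i, 0 < n i
  isUp : ∀ i, ZMod (n i + n (i + 1)) → Bool
  lo : ∀ i, ZMod (n i + n (i + 1)) → ZMod (n i)
  hi : ∀ i, ZMod (n i + n (i + 1)) → ZMod (n (i + 1))
  lo_step : ∀ i k, lo i (k + 1) = if isUp i k = true then lo i k + 1 else lo i k
  hi_step : ∀ i k, hi i (k + 1) = if isUp i k = true then hi i k else hi i k + 1
  lo_bij : ∀ i, Function.Bijective (fun k : {k // isUp i k = true} => lo i k)
  hi_bij : ∀ i, Function.Bijective (fun k : {k // isUp i k = false} => hi i k)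

namespace CausalTriangulation

variable {N : ℕ}

instance neZero_n (t : CausalTriangulation N) (i : ZMod N) : NeZero (t.n i) :=
  ⟨(t.n_pos i).ne'⟩

instance neZero_strip (t : CausalTriangulation N) (i : ZMod N) :
    NeZero (t.n i + t.n (i + 1)) :=
  ⟨(Nat.add_pos_left (t.n_pos i) _).ne'⟩

/-- Vertices `(i, a)`: vertex `a` of slice `i`. -/
abbrev Vertex (t : CausalTriangulation N) : Type := Σ i : ZMod N, ZMod (t.n i)

/-- Edges on the slices: `(i, a)` is the edge from `a` to `a + 1` on slice `i`. -/
abbrev SliceEdge (t : CausalTriangulation N) : Type := Σ i : ZMod N, ZMod (t.n i)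

/-- Edges crossing the strips: `(i, k)` is the `k`-th transversal edge of strip `i`. -/
abbrev CrossEdge (t : CausalTriangulation N) : Type :=
  Σ i : ZMod N, ZMod (t.n i + t.n (i + 1))

/-- All edges of the triangulation. -/
abbrev Edge (t : CausalTriangulation N) : Type := t.SliceEdge ⊕ t.CrossEdge

/-- Triangular faces: `(i, k)` is the `k`-th triangle of strip `i`, lying between the transversal
edges `k` and `k + 1` of that strip. -/
abbrev Face (t : CausalTriangulation N) : Type := Σ i : ZMod N, ZMod (t.n i + t.n (i + 1))

/-- The embedded graph of the triangulation. -/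
def graph (t : CausalTriangulation N) : Multigraph t.Vertex t.Edge where
  ends
    | Sum.inl ⟨i, a⟩ => s(⟨i, a⟩, ⟨i, a + 1⟩)
    | Sum.inr ⟨i, k⟩ => s(⟨i, t.lo i k⟩, ⟨i + 1, t.hi i k⟩)

/-- The base of an up-triangle: its unique edge on a slice (the lower one). -/
def upBase (t : CausalTriangulation N) (f : {f : t.Face // t.isUp f.1 f.2 = true}) :
    t.SliceEdge :=
  ⟨f.1.1, t.lo f.1.1 f.1.2⟩

/-- The base of a down-triangle: its unique edge on a slice (the upper one). -/
def downBase (t : CausalTriangulation N) (f : {f : t.Face // t.isUp f.1 f.2 = false}) :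
    t.SliceEdge :=
  ⟨f.1.1 + 1, t.hi f.1.1 f.1.2⟩

theorem upBase_bijective (t : CausalTriangulation N) : Function.Bijective t.upBase := by
  constructor
  · rintro ⟨⟨i, k⟩, hk⟩ ⟨⟨j, l⟩, hl⟩ h
    obtain ⟨h1, h2⟩ := Sigma.mk.inj_iff.mp h
    dsimp only at h1 hk hl h2
    subst h1
    have h3 := (t.lo_bij i).1 (a₁ := ⟨k, hk⟩) (a₂ := ⟨l, hl⟩) (eq_of_heq h2)
    cases h3
    rfl
  · rintro ⟨i, a⟩
    obtain ⟨⟨k, hk⟩, h⟩ := (t.lo_bij i).2 a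
    exact ⟨⟨⟨i, k⟩, hk⟩, by simp only [upBase]; exact congrArg (Sigma.mk i) h⟩

theorem downBase_bijective (t : CausalTriangulation N) : Function.Bijective t.downBase := by
  constructor
  · rintro ⟨⟨i, k⟩, hk⟩ ⟨⟨j, l⟩, hl⟩ h
    obtain ⟨h1, h2⟩ := Sigma.mk.inj_iff.mp h
    dsimp only at h1 hk hl h2
    have h1' := add_right_cancel h1
    subst h1'
    have h3 := (t.hi_bij i).1 (a₁ := ⟨k, hk⟩) (a₂ := ⟨l, hl⟩) (eq_of_heq h2)
    cases h3
    rfl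
  · rintro ⟨j, a⟩
    obtain ⟨i, rfl⟩ : ∃ i, j = i + 1 := ⟨j - 1, by ring⟩
    obtain ⟨⟨k, hk⟩, h⟩ := (t.hi_bij i).2 a
    exact ⟨⟨⟨i, k⟩, hk⟩, by simp only [downBase]; exact congrArg (Sigma.mk (i + 1)) h⟩

/-- The up-triangle with a given base, i.e. the triangle just above a slice edge. -/
noncomputable def faceAbove (t : CausalTriangulation N) (e : t.SliceEdge) : t.Face :=
  ((Equiv.ofBijective t.upBase t.upBase_bijective).symm e).1

/-- The down-triangle with a given base, i.e. the triangle just below a slice edge. -/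
noncomputable def faceBelow (t : CausalTriangulation N) (e : t.SliceEdge) : t.Face :=
  ((Equiv.ofBijective t.downBase t.downBase_bijective).symm e).1

/-- The dual graph `t*`: its vertices are the faces of `t`, its edges are in bijection with (and
labelled by) the edges of `t`, and the dual of `e` joins the two faces of `t` abutting `e`. -/
noncomputable def dualGraph (t : CausalTriangulation N) : Multigraph t.Face t.Edge where
  ends
    | Sum.inl e => s(t.faceBelow e, t.faceAbove e)
    | Sum.inr ⟨i, k⟩ => s(⟨i, k - 1⟩, ⟨i, k⟩)

end CausalTriangulation

/-- The dual parameter `p*(p,q) = (1-p)q / ((1-p)q + p)`. -/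
noncomputable def dualParam (p q : ℝ) : ℝ := (1 - p) * q / ((1 - p) * q + p)

/-! Complementing a configuration, `w ↦ 1 - w`, pairs the two sums term by term. The edge weights
then agree up to the stated prefactor and q^(number of open edges), so the bounds follow from
|#open(w) + k(w) - |V| - k*(1 - w)| ≤ 1 and monotonicity of powers of q ≥ 1. This estimate is linear
algebra over `ZMod 2`. Functions with zero coboundary on the open edges have dimension k(w). Their
coboundaries on the closed edges have rank at least k(w) - 1, as the graph is connected, and are
orthogonal to the dual coboundaries there, which have rank |F| - k*. Hence k(w) - 1 ≤ #closed - |F|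
+ k*, and |V| + |F| = |E| gives one bound; exchanging the two graphs gives the other
(`numClusters_add_card_le`). Orthogonality (`sum_coboundary_mul_coboundary`) holds because a
coboundary sums to zero around each triangle. -/

namespace Multigraph

/-! ### Cluster counts from mod 2 coboundaries -/

variable {V E : Type}

/-- The mod 2 coboundary of a function on the vertices of a multigraph. -/
def coboundary (G : Multigraph V E) : (V → ZMod 2) →ₗ[ZMod 2] (E → ZMod 2) where
  toFun x e := Sym2.lift ⟨fun a b => x a + x b, fun a b => add_comm (x a) (x b)⟩ (G.ends e)
  map_add' x y := by
    funext e
    induction h : G.ends e with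
    | h a b => simp only [h, Sym2.lift_mk, Pi.add_apply]; ring
  map_smul' c x := by
    funext e
    induction h : G.ends e with
    | h a b => simp only [h, Sym2.lift_mk, Pi.smul_apply, smul_eq_mul, RingHom.id_apply]; ring

theorem coboundary_apply_of_ends (G : Multigraph V E) (x : V → ZMod 2) {e : E} {a b : V}
    (h : G.ends e = s(a, b)) : G.coboundary x e = x a + x b := by
  simp [coboundary, h]

theorem add_eq_zero_iff_eq_zmod_two {a b : ZMod 2} : a + b = 0 ↔ a = b := by
  revert a b; decide

/-- The coboundary, restricted to a set of edges. -/
def coboundaryOn (G : Multigraph V E) (P : E → Prop) :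
    (V → ZMod 2) →ₗ[ZMod 2] ({e // P e} → ZMod 2) :=
  LinearMap.funLeft (ZMod 2) (ZMod 2) Subtype.val ∘ₗ G.coboundary

@[simp]
theorem coboundaryOn_apply (G : Multigraph V E) (P : E → Prop) (x : V → ZMod 2)
    (e : {e // P e}) : G.coboundaryOn P x e = G.coboundary x e := rfl

theorem mem_ker_coboundaryOn_open (G : Multigraph V E) (w : E → Fin 2) (x : V → ZMod 2) :
    x ∈ LinearMap.ker (G.coboundaryOn (fun e => w e = 1)) ↔
      ∀ a b, (G.openGraph w).Adj a b → x a = x b := by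
  rw [LinearMap.mem_ker]
  constructor
  · rintro h a b ⟨-, e, he, hab⟩
    have := congrFun h ⟨e, he⟩
    rw [coboundaryOn_apply, G.coboundary_apply_of_ends x hab] at this
    exact add_eq_zero_iff_eq_zmod_two.1 this
  · intro h
    funext ⟨e, he⟩
    induction hab : G.ends e with
    | h a b =>
      rw [coboundaryOn_apply, G.coboundary_apply_of_ends x hab]
      refine add_eq_zero_iff_eq_zmod_two.2 ?_
      -- A loop has zero coboundary mod 2, so its omission from `openGraph` is harmless.
      by_cases hne : a = b
      · rw [hne]
      · exact h a b ⟨hne, e, he, hab⟩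

/-- Functions with zero coboundary on the open edges are the functions of the open clusters. -/
noncomputable def kerCoboundaryOnEquiv (G : Multigraph V E) (w : E → Fin 2) :
    LinearMap.ker (G.coboundaryOn (fun e => w e = 1)) ≃ₗ[ZMod 2]
      ((G.openGraph w).ConnectedComponent → ZMod 2) where
  toFun x := fun c => x.1 c.out
  map_add' _ _ := rfl
  map_smul' _ _ := rfl
  invFun y := ⟨fun v => y ((G.openGraph w).connectedComponentMk v),
    (G.mem_ker_coboundaryOn_open w _).2 fun a b h =>
      congrArg y (SimpleGraph.ConnectedComponent.eq.2 h.reachable)⟩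
  left_inv x := by
    ext v
    have key : ∀ a b, (G.openGraph w).Reachable a b → x.1 a = x.1 b := by
      rintro a b ⟨p⟩
      induction p with
      | nil => rfl
      | cons h _ ih => exact ((G.mem_ker_coboundaryOn_open w _).1 x.2 _ _ h).trans ih
    exact key _ _ (SimpleGraph.ConnectedComponent.eq.1 (Quot.out_eq _))
  right_inv y := by
    funext c
    exact congrArg y (Quot.out_eq c)

theorem finrank_ker_coboundaryOn_open [Finite V] (G : Multigraph V E) (w : E → Fin 2) :
    Module.finrank (ZMod 2) (LinearMap.ker (G.coboundaryOn (fun e => w e = 1))) =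
      G.numClusters w := by
  have := Fintype.ofFinite (G.openGraph w).ConnectedComponent
  rw [(G.kerCoboundaryOnEquiv w).finrank_eq, Module.finrank_fintype_fun_eq_card,
    numClusters, Nat.card_eq_fintype_card]

/-- If the coboundaries of `G` and `G'` are orthogonal, and only constants have zero coboundary
in `G`, then the clusters of a configuration in `G` are bounded by the cycle rank of the dual
configuration in `G'` plus one. -/
theorem numClusters_add_card_le {V' : Type} [Finite V] [Fintype V'] [Fintype E]
    (G : Multigraph V E) (G' : Multigraph V' E)
    (horth : ∀ x y, ∑ e, G.coboundary x e * G'.coboundary y e = 0)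
    (hconn : ∀ x, G.coboundary x = 0 → ∀ a b, x a = x b) (w w' : E → Fin 2)
    (hw : ∀ e, w' e = 1 ↔ w e ≠ 1) :
    G.numClusters w + Fintype.card V' ≤
      Fintype.card {e // w' e = 1} + G'.numClusters w' + 1 := by
  classical
  have := Fintype.ofFinite V
  let A := G.coboundaryOn (fun e => w e = 1)
  let B := G'.coboundaryOn (fun e => w' e = 1)
  let φ : LinearMap.ker A →ₗ[ZMod 2] ({e // w' e = 1} → ZMod 2) :=
    G.coboundaryOn (fun e => w' e = 1) ∘ₗ (LinearMap.ker A).subtype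
  -- The kernel of `D.mulVecLin` is the orthogonal complement of the range of `B`.
  let D := (LinearMap.toMatrix' B).transpose
  have hA : Module.finrank (ZMod 2) (LinearMap.ker A) = G.numClusters w :=
    G.finrank_ker_coboundaryOn_open w
  have hB : Module.finrank (ZMod 2) (LinearMap.ker B) = G'.numClusters w' :=
    G'.finrank_ker_coboundaryOn_open w'
  have hφ := φ.finrank_range_add_finrank_ker
  have hBr := B.finrank_range_add_finrank_ker
  have hDr := D.mulVecLin.finrank_range_add_finrank_ker
  have hrank : Module.finrank (ZMod 2) (LinearMap.range D.mulVecLin) =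
      Module.finrank (ZMod 2) (LinearMap.range B) := by
    change D.rank = _
    rw [Matrix.rank_transpose, Matrix.rank, ← Matrix.toLin'_apply', Matrix.toLin'_toMatrix']
  have hle : LinearMap.range φ ≤ LinearMap.ker D.mulVecLin := by
    rintro _ ⟨x, rfl⟩
    rw [LinearMap.mem_ker, Matrix.mulVecLin_apply]
    refine dotProduct_eq_zero _ fun y => ?_
    rw [Matrix.mulVec_transpose, ← Matrix.dotProduct_mulVec, LinearMap.toMatrix'_mulVec]
    have h0 := horth x.1 y
    rw [← Fintype.sum_subtype_add_sum_subtype (fun e => w' e = 1)] at h0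
    -- Edges closed in `w'` are open in `w`, where the coboundary of `x` vanishes.
    have hz : ∑ e : {e // ¬ w' e = 1}, G.coboundary x.1 e * G'.coboundary y e = 0 := by
      refine Finset.sum_eq_zero fun e _ => ?_
      have he : w e = 1 := by
        by_contra h
        exact e.2 ((hw e).2 h)
      have := congrFun (LinearMap.mem_ker.1 x.2) ⟨e, he⟩
      change G.coboundary x.1 e = 0 at this
      rw [this, zero_mul]
    rw [hz, add_zero] at h0
    exact h0
  -- Zero coboundary on both open and closed edges forces a constant, so evaluation at one vertex is
  -- injective.
  have hker : Module.finrank (ZMod 2) (LinearMap.ker φ) ≤ 1 := by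
    rcases isEmpty_or_nonempty V with hV | ⟨⟨v⟩⟩
    · have : Module.finrank (ZMod 2) (LinearMap.ker φ) = 0 := Module.finrank_zero_of_subsingleton
      omega
    let ev : LinearMap.ker φ →ₗ[ZMod 2] ZMod 2 :=
      LinearMap.proj v ∘ₗ (LinearMap.ker A).subtype ∘ₗ (LinearMap.ker φ).subtype
    have hev : Function.Injective ev := by
      rw [← LinearMap.ker_eq_bot, LinearMap.ker_eq_bot']
      intro x hx
      have hcob : G.coboundary x.1.1 = 0 := by
        funext e
        by_cases he : w e = 1
        · exact congrFun (LinearMap.mem_ker.1 x.1.2) ⟨e, he⟩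
        · exact congrFun (LinearMap.mem_ker.1 x.2) ⟨e, (hw e).2 he⟩
      ext a
      exact (hconn _ hcob a v).trans hx
    simpa using LinearMap.finrank_le_finrank_of_injective hev
  have hmono := Submodule.finrank_mono hle
  simp only [Module.finrank_fintype_fun_eq_card] at hBr hDr
  omega

/-- The partition function does not depend on how the configurations are enumerated. -/
theorem fkPartition_eq_sum [Fintype E] [inst : Fintype (E → Fin 2)] (p q : ℝ)
    (G : Multigraph V E) :
    G.fkPartition p q = ∑ w : E → Fin 2,
      (∏ e, (1 - p) ^ (1 - (w e : ℕ)) * p ^ (w e : ℕ)) * q ^ G.numClusters w := by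
  rw [Subsingleton.elim inst]
  rfl

end Multigraph

/-! ### Connectivity and orthogonality on the torus -/

namespace CausalTriangulation

variable {N : ℕ}

theorem zmod_const_of_step {α : Type} {n : ℕ} [NeZero n] (f : ZMod n → α)
    (h : ∀ k, f (k + 1) = f k) (a b : ZMod n) : f a = f b := by
  have key : ∀ m : ℕ, f (m : ZMod n) = f 0 := by
    intro m
    induction m with
    | zero => simp
    | succ m ih => rw [Nat.cast_succ, h, ih]
  rw [← ZMod.natCast_zmod_val a, ← ZMod.natCast_zmod_val b, key, key]

theorem coboundary_graph_slice (t : CausalTriangulation N) (x : t.Vertex → ZMod 2)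
    (e : t.SliceEdge) :
    t.graph.coboundary x (Sum.inl e) = x e + x ⟨e.1, e.2 + 1⟩ :=
  t.graph.coboundary_apply_of_ends x rfl

theorem coboundary_graph_cross (t : CausalTriangulation N) (x : t.Vertex → ZMod 2)
    (i : ZMod N) (k : ZMod (t.n i + t.n (i + 1))) :
    t.graph.coboundary x (Sum.inr ⟨i, k⟩) = x ⟨i, t.lo i k⟩ + x ⟨i + 1, t.hi i k⟩ :=
  t.graph.coboundary_apply_of_ends x rfl

theorem coboundary_dualGraph_slice (t : CausalTriangulation N) (y : t.Face → ZMod 2)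
    (e : t.SliceEdge) :
    t.dualGraph.coboundary y (Sum.inl e) = y (t.faceBelow e) + y (t.faceAbove e) :=
  t.dualGraph.coboundary_apply_of_ends y rfl

theorem coboundary_dualGraph_cross (t : CausalTriangulation N) (y : t.Face → ZMod 2)
    (i : ZMod N) (k : ZMod (t.n i + t.n (i + 1))) :
    t.dualGraph.coboundary y (Sum.inr ⟨i, k⟩) = y ⟨i, k - 1⟩ + y ⟨i, k⟩ :=
  t.dualGraph.coboundary_apply_of_ends y rfl

theorem faceAbove_upBase (t : CausalTriangulation N)
    (f : {f : t.Face // t.isUp f.1 f.2 = true}) : t.faceAbove (t.upBase f) = f.1 :=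
  congrArg Subtype.val ((Equiv.ofBijective t.upBase t.upBase_bijective).symm_apply_apply f)

theorem faceBelow_downBase (t : CausalTriangulation N)
    (f : {f : t.Face // t.isUp f.1 f.2 = false}) : t.faceBelow (t.downBase f) = f.1 :=
  congrArg Subtype.val ((Equiv.ofBijective t.downBase t.downBase_bijective).symm_apply_apply f)

/-- Only the constants have zero coboundary: the triangulation is connected. -/
theorem graph_coboundary_eq_zero [NeZero N] (t : CausalTriangulation N)
    (x : t.Vertex → ZMod 2) (hx : t.graph.coboundary x = 0) (a b : t.Vertex) : x a = x b := by
  have hs : ∀ i (a b : ZMod (t.n i)), x ⟨i, a⟩ = x ⟨i, b⟩ := fun i =>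
    zmod_const_of_step (fun a => x ⟨i, a⟩) fun k => by
      have := congrFun hx (Sum.inl ⟨i, k⟩)
      rw [coboundary_graph_slice] at this
      exact (Multigraph.add_eq_zero_iff_eq_zmod_two.1 this).symm
  have hc := zmod_const_of_step (fun i => x ⟨i, 0⟩) fun i => by
    have := congrFun hx (Sum.inr ⟨i, 0⟩)
    rw [coboundary_graph_cross] at this
    exact ((hs _ _ _).trans (Multigraph.add_eq_zero_iff_eq_zmod_two.1 this).symm).trans (hs _ _ _)
  exact ((hs a.1 a.2 0).trans (hc a.1 b.1)).trans (hs b.1 0 b.2)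

/-- Only the constants have zero coboundary: the dual graph is connected. -/
theorem dualGraph_coboundary_eq_zero [NeZero N] (t : CausalTriangulation N)
    (y : t.Face → ZMod 2) (hy : t.dualGraph.coboundary y = 0) (a b : t.Face) : y a = y b := by
  have hs : ∀ i (a b : ZMod (t.n i + t.n (i + 1))), y ⟨i, a⟩ = y ⟨i, b⟩ := fun i =>
    zmod_const_of_step (fun a => y ⟨i, a⟩) fun k => by
      have := congrFun hy (Sum.inr ⟨i, k + 1⟩)
      rw [coboundary_dualGraph_cross, add_sub_cancel_right] at this
      exact (Multigraph.add_eq_zero_iff_eq_zmod_two.1 this).symm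
  have hc := zmod_const_of_step (fun i => y ⟨i, 0⟩) fun i => by
    obtain ⟨f, hf⟩ := t.downBase_bijective.2 ⟨i + 1, 0⟩
    obtain ⟨g, hg⟩ := t.upBase_bijective.2 ⟨i + 1, 0⟩
    have := congrFun hy (Sum.inl ⟨i + 1, 0⟩)
    rw [coboundary_dualGraph_slice] at this
    -- The same slice edge is the base of `f` below it and of `g` above it, so each occurrence is
    -- rewritten separately.
    nth_rewrite 1 [← hf] at this
    rw [← hg, faceBelow_downBase, faceAbove_upBase] at this
    have hf1 : f.1.1 = i := add_right_cancel (congrArg Sigma.fst hf)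
    have hg1 : g.1.1 = i + 1 := congrArg Sigma.fst hg
    have hf0 : y ⟨i, 0⟩ = y f.1 := by rw [← hf1]; exact hs _ _ _
    have hg0 : y ⟨i + 1, 0⟩ = y g.1 := by rw [← hg1]; exact hs _ _ _
    exact (hg0.trans (Multigraph.add_eq_zero_iff_eq_zmod_two.1 this).symm).trans hf0.symm
  exact ((hs a.1 a.2 0).trans (hc a.1 b.1)).trans (hs b.1 0 b.2)

/-- The coboundary around a triangle: its base contributes the sum of its two transversal
edges. -/
theorem sum_slice_coboundary_mul [NeZero N] (t : CausalTriangulation N)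
    (x : t.Vertex → ZMod 2) (y : t.Face → ZMod 2) :
    ∑ e : t.SliceEdge, t.graph.coboundary x (Sum.inl e) * t.dualGraph.coboundary y (Sum.inl e) =
      ∑ f : t.Face, (t.graph.coboundary x (Sum.inr f) +
        t.graph.coboundary x (Sum.inr ⟨f.1, f.2 + 1⟩)) * y f := by
  simp only [coboundary_dualGraph_slice, mul_add, Finset.sum_add_distrib]
  rw [← Fintype.sum_subtype_add_sum_subtype (fun f : t.Face => t.isUp f.1 f.2 = true), add_comm]
  have h2 : ∀ a : ZMod 2, a + a = 0 := by decide
  congr 1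
  · rw [← (Equiv.ofBijective t.upBase t.upBase_bijective).sum_comp]
    refine Finset.sum_congr rfl fun f _ => ?_
    obtain ⟨⟨i, k⟩, hk⟩ := f
    rw [Equiv.ofBijective_apply, faceAbove_upBase, coboundary_graph_slice, coboundary_graph_cross,
      coboundary_graph_cross]
    dsimp only at hk ⊢
    rw [t.lo_step, t.hi_step, if_pos hk, if_pos hk]
    congr 1
    change x ⟨i, t.lo i k⟩ + x ⟨i, t.lo i k + 1⟩ = _
    -- The two transversal sides of an up-triangle share their upper end, whose value cancels mod 2.
    linear_combination -h2 (x ⟨i + 1, t.hi i k⟩)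
  · rw [← (Equiv.ofBijective t.downBase t.downBase_bijective).sum_comp]
    refine Fintype.sum_equiv (Equiv.subtypeEquivRight fun f => (Bool.not_eq_true _).symm ▸ Iff.rfl)
      _ _ fun f => ?_
    obtain ⟨⟨i, k⟩, hk⟩ := f
    rw [Equiv.ofBijective_apply, faceBelow_downBase, coboundary_graph_slice]
    change _ = (t.graph.coboundary x (Sum.inr ⟨i, k⟩) +
      t.graph.coboundary x (Sum.inr ⟨i, k + 1⟩)) * y ⟨i, k⟩
    rw [coboundary_graph_cross, coboundary_graph_cross]
    dsimp only at hk ⊢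
    have hk' : ¬ t.isUp i k = true := by simp [hk]
    rw [t.lo_step, t.hi_step, if_neg hk', if_neg hk']
    congr 1
    change x ⟨i + 1, t.hi i k⟩ + x ⟨i + 1, t.hi i k + 1⟩ = _
    linear_combination -h2 (x ⟨i, t.lo i k⟩)

/-- Summation by parts around each strip. -/
theorem sum_cross_coboundary_mul [NeZero N] (t : CausalTriangulation N)
    (x : t.Vertex → ZMod 2) (y : t.Face → ZMod 2) :
    ∑ e : t.CrossEdge, t.graph.coboundary x (Sum.inr e) * t.dualGraph.coboundary y (Sum.inr e) =
      ∑ f : t.Face, (t.graph.coboundary x (Sum.inr f) +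
        t.graph.coboundary x (Sum.inr ⟨f.1, f.2 + 1⟩)) * y f := by
  rw [Fintype.sum_sigma, Fintype.sum_sigma]
  refine Finset.sum_congr rfl fun i _ => ?_
  simp only [coboundary_dualGraph_cross, mul_add, add_mul, Finset.sum_add_distrib]
  rw [add_comm]
  congr 1
  rw [← Equiv.sum_comp (Equiv.addRight (1 : ZMod (t.n i + t.n (i + 1))))]
  simp

theorem sum_coboundary_mul_coboundary [NeZero N] (t : CausalTriangulation N)
    (x : t.Vertex → ZMod 2) (y : t.Face → ZMod 2) :
    ∑ e, t.graph.coboundary x e * t.dualGraph.coboundary y e = 0 := by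
  rw [Fintype.sum_sum_type, sum_slice_coboundary_mul, sum_cross_coboundary_mul]
  exact Multigraph.add_eq_zero_iff_eq_zmod_two.2 rfl

/-- Euler's relation on the torus. -/
theorem card_vertex_add_card_face [NeZero N] (t : CausalTriangulation N) :
    Fintype.card t.Vertex + Fintype.card t.Face = Fintype.card t.Edge := by
  -- Slice edges carry the same labels as vertices, and cross edges the same labels as faces.
  rw [Fintype.card_sum]

/-! ### Comparison of primal and dual cluster counts -/

theorem card_open {α : Type*} [Fintype α] (w : α → Fin 2) :
    Fintype.card {e // w e = 1} = ∑ e, (w e : ℕ) := by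
  rw [Fintype.card_subtype, Finset.card_filter]
  refine Finset.sum_congr rfl fun e _ => ?_
  generalize w e = a
  revert a; decide

theorem card_closed {α : Type*} [Fintype α] (w : α → Fin 2) :
    Fintype.card {e // 1 - w e = 1} + ∑ e, (w e : ℕ) = Fintype.card α := by
  rw [Fintype.card_subtype, Finset.card_filter, ← Finset.sum_add_distrib, Fintype.card,
    Finset.card_eq_sum_ones]
  refine Finset.sum_congr rfl fun e _ => ?_
  generalize w e = a
  revert a; decide

theorem numClusters_le [NeZero N] (t : CausalTriangulation N) (w : t.Edge → Fin 2) :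
    ∑ e, (w e : ℕ) + t.graph.numClusters w ≤
      Fintype.card t.Vertex + t.dualGraph.numClusters (fun e => 1 - w e) + 1 := by
  have h := t.graph.numClusters_add_card_le t.dualGraph t.sum_coboundary_mul_coboundary
    t.graph_coboundary_eq_zero w (fun e => 1 - w e)
    (fun e => by generalize w e = a; revert a; decide)
  have h1 := card_closed w
  have h2 := t.card_vertex_add_card_face
  omega

/-- The roles of the graph and its dual are exchanged; connectedness of the dual enters here. -/
theorem numClusters_dual_le [NeZero N] (t : CausalTriangulation N) (w : t.Edge → Fin 2) :
    Fintype.card t.Vertex + t.dualGraph.numClusters (fun e => 1 - w e) ≤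
      ∑ e, (w e : ℕ) + t.graph.numClusters w + 1 := by
  have h := t.dualGraph.numClusters_add_card_le t.graph
    (fun y x => by simpa only [mul_comm] using t.sum_coboundary_mul_coboundary x y)
    t.dualGraph_coboundary_eq_zero (fun e => 1 - w e) w
    (fun e => by generalize w e = a; revert a; decide)
  have h1 := card_open w
  omega

end CausalTriangulation

/-! ### Weights at the dual parameter and the duality bounds -/

theorem one_sub_dualParam {p q : ℝ} (hp0 : 0 < p) (hp1 : p < 1) (hq : 0 < q) :
    1 - dualParam p q = p / ((1 - p) * q + p) := by
  have : 0 < (1 - p) * q + p := by have := mul_pos (sub_pos.2 hp1) hq; linarith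
  rw [dualParam]
  field_simp
  ring

/-- The weight of a configuration in terms of that of the dual configuration at the dual
parameter. -/
theorem weight_eq_dual_weight {E : Type} [Fintype E] {p q : ℝ} (hp0 : 0 < p) (hp1 : p < 1)
    (hq : 0 < q) (w : E → Fin 2) :
    ∏ e, ((1 - p) ^ (1 - (w e : ℕ)) * p ^ (w e : ℕ)) =
      (p / (1 - dualParam p q)) ^ Fintype.card E * q ^ (-(Fintype.card E : ℤ)) *
        (∏ e, (1 - dualParam p q) ^ (1 - ((1 - w e : Fin 2) : ℕ)) *
          dualParam p q ^ ((1 - w e : Fin 2) : ℕ)) * q ^ (∑ e, (w e : ℕ)) := by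
  have hs : 0 < (1 - p) * q + p := by have := mul_pos (sub_pos.2 hp1) hq; linarith
  -- The identity holds edge by edge: with s = p/(1 - p*) = (1 - p)q + p, one has 1 - p = (s/q)p*
  -- and p = (s/q)(1 - p*)q.
  rw [zpow_neg, zpow_natCast, ← inv_pow, ← mul_pow, Fintype.card, ← Finset.prod_const,
    ← Finset.prod_mul_distrib, ← Finset.prod_pow_eq_pow_sum, ← Finset.prod_mul_distrib]
  refine Finset.prod_congr rfl fun e _ => ?_
  rw [one_sub_dualParam hp0 hp1 hq, dualParam]
  generalize w e = a
  fin_cases a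
  · simp
    field_simp
  · simp
    field_simp

/-- Duality for the dual parameter, as a fixed point equation. -/
theorem eq_dualParam_iff {p q : ℝ} (hp0 : 0 < p) (hp1 : p < 1) (hq : 0 < q) (x : ℝ) :
    x = dualParam p q ↔ x ≠ 1 ∧ x / (1 - x) * (p / (1 - p)) = q := by
  have h1p : 0 < 1 - p := sub_pos.2 hp1
  have hs : 0 < (1 - p) * q + p := by have := mul_pos h1p hq; linarith
  constructor
  · rintro rfl
    have h := one_sub_dualParam hp0 hp1 hq
    have hpos : 0 < p / ((1 - p) * q + p) := div_pos hp0 hs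
    refine ⟨fun h1 => by rw [h1, sub_self] at h; exact hpos.ne h, ?_⟩
    rw [h, dualParam]
    field_simp
  · rintro ⟨hx, h⟩
    have hx' : 1 - x ≠ 0 := sub_ne_zero.2 hx.symm
    rw [div_mul_div_comm, div_eq_iff (mul_ne_zero hx' h1p.ne')] at h
    rw [dualParam, eq_div_iff hs.ne']
    linear_combination h

theorem lemma3p1 (N : ℕ) [NeZero N] (t : CausalTriangulation N)
    (p q : ℝ) (hp0 : 0 < p) (hp1 : p < 1) (hq : 1 ≤ q) :
    (t.graph.fkPartition p q ≤
      (p / (1 - dualParam p q)) ^ Fintype.card t.Edge *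
        q ^ ((Fintype.card t.Vertex : ℤ) - (Fintype.card t.Edge : ℤ) + 1) *
        t.dualGraph.fkPartition (dualParam p q) q) ∧
    ((p / (1 - dualParam p q)) ^ Fintype.card t.Edge *
        q ^ ((Fintype.card t.Vertex : ℤ) - (Fintype.card t.Edge : ℤ) - 1) *
        t.dualGraph.fkPartition (dualParam p q) q ≤
      t.graph.fkPartition p q) ∧
    (∀ x : ℝ, x = dualParam p q ↔ x ≠ 1 ∧ x / (1 - x) * (p / (1 - p)) = q) := by
  classical
  have hq0 : 0 < q := zero_lt_one.trans_le hq
  have hs : 0 < (1 - p) * q + p := by have := mul_pos (sub_pos.2 hp1) hq0; linarith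
  have hd0 : 0 ≤ dualParam p q := div_nonneg (mul_pos (sub_pos.2 hp1) hq0).le hs.le
  have hd1 : 0 < 1 - dualParam p q := by
    rw [one_sub_dualParam hp0 hp1 hq0]; exact div_pos hp0 hs
  have hdual : t.dualGraph.fkPartition (dualParam p q) q =
      ∑ w : t.Edge → Fin 2, (∏ e, (1 - dualParam p q) ^ (1 - ((1 - w e : Fin 2) : ℕ)) *
          dualParam p q ^ ((1 - w e : Fin 2) : ℕ)) *
        q ^ t.dualGraph.numClusters (fun e => 1 - w e) := by
    rw [Multigraph.fkPartition_eq_sum]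
    exact (Equiv.sum_comp (Equiv.subLeft (1 : t.Edge → Fin 2)) _).symm
  have hnn : ∀ w : t.Edge → Fin 2, 0 ≤ (p / (1 - dualParam p q)) ^ Fintype.card t.Edge *
      (∏ e, (1 - dualParam p q) ^ (1 - ((1 - w e : Fin 2) : ℕ)) *
        dualParam p q ^ ((1 - w e : Fin 2) : ℕ)) := fun w =>
    mul_nonneg (pow_nonneg (div_pos hp0 hd1).le _)
      (Finset.prod_nonneg fun e _ => mul_nonneg (pow_nonneg hd1.le _) (pow_nonneg hd0 _))
  refine ⟨?_, ?_, eq_dualParam_iff hp0 hp1 hq0⟩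
  · rw [hdual, Multigraph.fkPartition_eq_sum, Finset.mul_sum]
    refine Finset.sum_le_sum fun w _ => ?_
    rw [weight_eq_dual_weight hp0 hp1 hq0]
    have hz : q ^ (-(Fintype.card t.Edge : ℤ)) * q ^ (∑ e, (w e : ℕ)) *
        q ^ t.graph.numClusters w ≤
        q ^ ((Fintype.card t.Vertex : ℤ) - (Fintype.card t.Edge : ℤ) + 1) *
        q ^ t.dualGraph.numClusters (fun e => 1 - w e) := by
      simp only [← zpow_natCast, ← zpow_add₀ hq0.ne']
      -- Since q ≥ 1, it suffices to compare exponents.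
      refine zpow_le_zpow_right₀ hq ?_
      have := t.numClusters_le w
      omega
    convert mul_le_mul_of_nonneg_left hz (hnn w) using 1 <;> ring
  · rw [hdual, Multigraph.fkPartition_eq_sum, Finset.mul_sum]
    refine Finset.sum_le_sum fun w _ => ?_
    rw [weight_eq_dual_weight hp0 hp1 hq0]
    have hz : q ^ ((Fintype.card t.Vertex : ℤ) - (Fintype.card t.Edge : ℤ) - 1) *
        q ^ t.dualGraph.numClusters (fun e => 1 - w e) ≤
        q ^ (-(Fintype.card t.Edge : ℤ)) * q ^ (∑ e, (w e : ℕ)) *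
        q ^ t.graph.numClusters w := by
      simp only [← zpow_natCast, ← zpow_add₀ hq0.ne']
      refine zpow_le_zpow_right₀ hq ?_
      have := t.numClusters_dual_le w
      omega
    convert mul_le_mul_of_nonneg_left hz (hnn w) using 1 <;> ring
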